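/- Let $p,q\geq 1$ be integers and let $(\bar M,\bar g)$ be a smooth finite-dimensional semi-Riemannian manifold with Levi-Civita connection $\bar\nabla$, equipped with a metallic structure $\bar J$, i.e. a smooth $(1,1)$-tensor field with $\bar J^2=p\bar J+qI$ and $\bar g(U,\bar JV)=\bar g(\bar JU,V)$. Let $\eta$ be a smooth vector field on $\bar M$, $\pi(V)=\bar g(V,\eta)$, and let $\bar D$ be the quarter symmetric non-metric connection $$\bar D_UV=\bar\nabla_UV+\pi(V)\bar JU .$$ Let $(M,g,S(TM),S(TM^\perp))$ be an $r$-lightlike submanifold of $\bar M$ with $r>0$: the radical distribution $\mathrm{Rad}(TM)=TM\cap TM^\perp$ is smooth of constant rank $r$, $S(TM)$ and $S(TM^\perp)$ are smooth complements of $\mathrm{Rad}(TM)$ in $TM$ and in $TM^\perp$, and $\mathrm{ltr}(TM)$ is a lightlike transversal bundle, i.e. a smooth totally null complement of $\mathrm{Rad}(TM)$ in the orthogonal complement of $S(TM)\perp S(TM^\perp)$ in $T\bar M|_M$. Thus $T\bar M|_M=TM\oplus(\mathrm{ltr}(TM)\perp S(TM^\perp))$ and $TM=\mathrm{Rad}(TM)\perp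 S(TM)$. For $U\in\Gamma(TM)$ and $V\in\Gamma(S(TM))$ let $D_UV$ be the $TM$-component of $\bar D_UV$ and let $\bar h^*(U,V)$ be the $\mathrm{Rad}(TM)$-component of $D_UV$ with respect to these decompositions. Assume that $M$ is invariant, i.e. $\bar J\,\mathrm{Rad}(TM)=\mathrm{Rad}(TM)$ and $\bar J S(TM)=S(TM)$, and that $(\bar\nabla_U\bar J)V=0$ for all $U,V$ tangent to $M$; equivalently, $\bar D_U\bar JV=\bar J\bar D_UV-p\,\pi(V)\bar JU-q\,\pi(V)U+\pi(\bar JV)\bar JU$ for all $U,V\in\Gamma(TM)$. Then the screen distribution $S(TM)$ is integrable (that is, $[U,V]\in\Gamma(S(TM))$ for all $U,V\in\Gamma(S(TM))$) if and only if $$\bar h^*(V,\bar JU)+p\,\bar h^*(U,V)=\bar h^*(U,\bar JV)+p\,\bar h^*(V,U)\qquad\text{for all }U,V\in\Gamma(S(TM)).$$ -/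

import Mathlib

open Bundle Module
open scoped Manifold ContDiff Topology

noncomputable section

namespace MetallicLightlike

/-! ### Semi-Riemannian metrics, metallic structures, connections -/

section Ambient

variable (E : Type*) [NormedAddCommGroup E] [NormedSpace ℝ E]
  (N : Type*) [TopologicalSpace N] [ChartedSpace E N] [IsManifold 𝓘(ℝ, E) ∞ N]

/-- A smooth semi-Riemannian metric: a smooth field of nondegenerate symmetric bilinear forms of
constant index (the index is the largest dimension of a negative definite subspace). -/
structure SemiRiemannianMetric where
  val : ∀ x : N, TangentSpace 𝓘(ℝ, E) x →L[ℝ] TangentSpace 𝓘(ℝ, E) x →L[ℝ] ℝ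
  symm : ∀ x u v, val x u v = val x v u
  nondegenerate : ∀ x u, (∀ v, val x u v = 0) → u = 0
  index : ℕ
  index_spec : ∀ x : N, IsGreatest {k : ℕ | ∃ W : Submodule ℝ (TangentSpace 𝓘(ℝ, E) x),
    finrank ℝ W = k ∧ ∀ w ∈ W, w ≠ 0 → val x w w < 0} index
  smooth : ContMDiff 𝓘(ℝ, E) (𝓘(ℝ, E).prod 𝓘(ℝ, E →L[ℝ] E →L[ℝ] ℝ)) ∞
    (fun x ↦ TotalSpace.mk' (E →L[ℝ] E →L[ℝ] ℝ)
      (E := fun x : N ↦ TangentSpace 𝓘(ℝ, E) x →L[ℝ] TangentSpace 𝓘(ℝ, E) x →L[ℝ] ℝ) x (val x))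

variable {E N}

/-- The metric at a point, as a bilinear form. -/
def SemiRiemannianMetric.form (g : SemiRiemannianMetric E N) (x : N) :
    LinearMap.BilinForm ℝ (TangentSpace 𝓘(ℝ, E) x) :=
  (g.val x).toBilinForm

/-- A smooth vector field. -/
def IsSmoothVectorField (X : ∀ x : N, TangentSpace 𝓘(ℝ, E) x) : Prop :=
  ContMDiff 𝓘(ℝ, E) (𝓘(ℝ, E).prod 𝓘(ℝ, E)) ∞
    (fun x ↦ TotalSpace.mk' E (E := (TangentSpace 𝓘(ℝ, E) : N → Type _)) x (X x))

/-- A vector field, differentiable at a given point. -/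
def VectorFieldDifferentiableAt (X : ∀ x : N, TangentSpace 𝓘(ℝ, E) x) (x : N) : Prop :=
  MDifferentiableAt 𝓘(ℝ, E) (𝓘(ℝ, E).prod 𝓘(ℝ, E))
    (fun y ↦ TotalSpace.mk' E (E := (TangentSpace 𝓘(ℝ, E) : N → Type _)) y (X y)) x

/-- A distribution is integrable if its smooth sections are closed under the Lie bracket. -/
def IsIntegrableDistribution (Δ : ∀ x : N, Submodule ℝ (TangentSpace 𝓘(ℝ, E) x)) : Prop :=
  ∀ U V : ∀ x : N, TangentSpace 𝓘(ℝ, E) x,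
    IsSmoothVectorField U → IsSmoothVectorField V → (∀ x, U x ∈ Δ x) → (∀ x, V x ∈ Δ x) →
      ∀ x, VectorField.mlieBracket 𝓘(ℝ, E) U V x ∈ Δ x

/-- A `(p, q)`-metallic structure `J` on `(N, g)`: a smooth `(1, 1)`-tensor field with
`J² = p J + q I`, for which `g` is `J`-compatible. -/
structure MetallicStructure (g : SemiRiemannianMetric E N) (p q : ℕ) where
  J : ∀ x : N, TangentSpace 𝓘(ℝ, E) x →L[ℝ] TangentSpace 𝓘(ℝ, E) x
  smooth : ContMDiff 𝓘(ℝ, E) (𝓘(ℝ, E).prod 𝓘(ℝ, E →L[ℝ] E)) ∞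
    (fun x ↦ TotalSpace.mk' (E →L[ℝ] E)
      (E := fun x : N ↦ TangentSpace 𝓘(ℝ, E) x →L[ℝ] TangentSpace 𝓘(ℝ, E) x) x (J x))
  sq : ∀ x v, J x (J x v) = (p : ℝ) • J x v + (q : ℝ) • v
  compatible : ∀ x u v, g.val x u (J x v) = g.val x (J x u) v

/-- Linear connections on `N`. In Mathlib's convention `conn Y x u` is `(∇_u Y)(x)`. -/
abbrev LinearConnection (E : Type*) [NormedAddCommGroup E] [NormedSpace ℝ E]
    (N : Type*) [TopologicalSpace N] [ChartedSpace E N] [IsManifold 𝓘(ℝ, E) ∞ N] :=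
  CovariantDerivative 𝓘(ℝ, E) E (TangentSpace 𝓘(ℝ, E) : N → Type _)

/-- The Levi-Civita connection: the torsion-free connection for which `g` is parallel. -/
structure IsLeviCivita (g : SemiRiemannianMetric E N) (conn : LinearConnection E N) : Prop where
  torsion_free : ∀ (X Y : ∀ x : N, TangentSpace 𝓘(ℝ, E) x) (x : N),
    VectorFieldDifferentiableAt X x → VectorFieldDifferentiableAt Y x →
      conn Y x (X x) - conn X x (Y x) = VectorField.mlieBracket 𝓘(ℝ, E) X Y x
  metric : ∀ (Y Z : ∀ x : N, TangentSpace 𝓘(ℝ, E) x) (x : N) (u : TangentSpace 𝓘(ℝ, E) x),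
    VectorFieldDifferentiableAt Y x → VectorFieldDifferentiableAt Z x →
      mvfderiv 𝓘(ℝ, E) (fun y ↦ g.val y (Y y) (Z y)) x u
        = g.val x (conn Y x u) (Z x) + g.val x (Y x) (conn Z x u)

/-- The quarter symmetric non-metric connection `D_U V = ∇_U V + π(V) J U`, where
`π(V) = g(V, η) = g(η, V)`. -/
def quarterSymmetricConnection (g : SemiRiemannianMetric E N) {p q : ℕ}
    (S : MetallicStructure g p q) (η : ∀ x : N, TangentSpace 𝓘(ℝ, E) x)
    (conn : LinearConnection E N) : LinearConnection E N :=
  conn.addOneForm fun x ↦ (g.val x (η x)).smulRight (S.J x)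

end Ambient

/-! ### Linear algebra behind the decomposition of the ambient tangent space -/

section Decomposition

variable {V : Type*} [AddCommGroup V] [Module ℝ V] [FiniteDimensional ℝ V]
  {B : LinearMap.BilinForm ℝ V} {T R S W L : Submodule ℝ V}

theorem disjoint_screens (hB : B.IsSymm) (hnd : B.Nondegenerate)
    (hR : R = T ⊓ B.orthogonal T) (hRS : R ⊓ S = ⊥) (hT : R ⊔ S = T)
    (hRW : R ⊓ W = ⊥) (hTp : R ⊔ W = B.orthogonal T) :
    (S ⊔ W) ⊓ B.orthogonal (S ⊔ W) = ⊥ := by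
  have hsymm : ∀ a b, B a b = B b a := fun a b ↦ by simpa using hB.eq a b
  have hST : S ≤ T := hT ▸ le_sup_right
  have hWT : W ≤ B.orthogonal T := hTp ▸ le_sup_right
  have hRT : R ≤ T := hT ▸ le_sup_left
  have hRTp : R ≤ B.orthogonal T := hTp ▸ le_sup_left
  rw [eq_bot_iff]
  rintro v ⟨hv, hvp⟩
  obtain ⟨s, hs, w, hw, rfl⟩ := Submodule.mem_sup.1 hv
  have hvp' : ∀ a ∈ S ⊔ W, B a (s + w) = 0 := hvp
  have hperp : ∀ a ∈ T, ∀ b ∈ B.orthogonal T, B a b = 0 := fun a ha b hb ↦ hb a ha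
  have hs0 : s = 0 := by
    have h1 : s ∈ B.orthogonal T := by
      intro a ha
      rw [← hT] at ha
      obtain ⟨r, hr, s', hs', rfl⟩ := Submodule.mem_sup.1 ha
      have e1 : B r s = 0 := by rw [hsymm]; exact hperp s (hST hs) r (hRTp hr)
      have e2 : B s' s = 0 := by
        have := hvp' s' (Submodule.mem_sup_left hs')
        rwa [map_add, hperp s' (hST hs') w (hWT hw), add_zero] at this
      simp [e1, e2]
    have : s ∈ R ⊓ S := ⟨hR ▸ ⟨hST hs, h1⟩, hs⟩
    simpa [hRS] using this
  subst hs0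
  have hw0 : w = 0 := by
    have h1 : w ∈ B.orthogonal (B.orthogonal T) := by
      intro a ha
      rw [← hTp] at ha
      obtain ⟨r, hr, w', hw', rfl⟩ := Submodule.mem_sup.1 ha
      have e1 : B r w = 0 := hperp r (hRT hr) w (hWT hw)
      have e2 : B w' w = 0 := by simpa using hvp' w' (Submodule.mem_sup_right hw')
      simp [e1, e2]
    rw [LinearMap.BilinForm.orthogonal_orthogonal hnd hB.isRefl] at h1
    have : w ∈ R ⊓ W := ⟨hR ▸ ⟨h1, hWT hw⟩, hw⟩
    simpa [hRW] using this
  simp [hw0]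

theorem isCompl_screens (hB : B.IsSymm) (hnd : B.Nondegenerate)
    (hR : R = T ⊓ B.orthogonal T) (hRS : R ⊓ S = ⊥) (hT : R ⊔ S = T)
    (hRW : R ⊓ W = ⊥) (hTp : R ⊔ W = B.orthogonal T)
    (hRL : R ⊓ L = ⊥) (hL : R ⊔ L = B.orthogonal (S ⊔ W)) :
    IsCompl T (L ⊔ W) ∧ IsCompl R (S ⊔ (L ⊔ W)) := by
  have hdisj := disjoint_screens hB hnd hR hRS hT hRW hTp
  have htop : (S ⊔ W) ⊔ (R ⊔ L) = ⊤ := by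
    rw [hL]
    exact ((LinearMap.BilinForm.isCompl_orthogonal_iff_disjoint hB.isRefl).2
      (disjoint_iff.2 hdisj)).sup_eq_top
  have key : ∀ r ∈ R, ∀ s ∈ S, ∀ n ∈ L, ∀ w ∈ W, r + s = n + w → r = 0 ∧ s + -w = 0 := by
    intro r hr s hs n hn w hw h
    have h1 : s + -w = n - r := by
      calc s + -w = (r + s) - r - w := by abel
        _ = n - r := by rw [h]; abel
    have h2 : s + -w ∈ (S ⊔ W) ⊓ B.orthogonal (S ⊔ W) := by
      refine ⟨Submodule.add_mem_sup hs (W.neg_mem hw), ?_⟩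
      rw [h1, ← hL]
      exact sub_mem (Submodule.mem_sup_right hn) (Submodule.mem_sup_left hr)
    have h3 : s + -w = 0 := by simpa [hdisj] using h2
    refine ⟨?_, h3⟩
    have h4 : n = r := by rw [h3] at h1; exact (sub_eq_zero.1 h1.symm)
    have : r ∈ R ⊓ L := ⟨hr, h4 ▸ hn⟩
    simpa [hRL] using this
  refine ⟨⟨disjoint_iff.2 (eq_bot_iff.2 ?_), codisjoint_iff.2 ?_⟩,
    ⟨disjoint_iff.2 (eq_bot_iff.2 ?_), codisjoint_iff.2 ?_⟩⟩
  · rintro v ⟨hv, hv'⟩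
    have hvT : v ∈ T := hv
    rw [← hT] at hv
    obtain ⟨r, hr, s, hs, rfl⟩ := Submodule.mem_sup.1 hv
    obtain ⟨n, hn, w, hw, h⟩ := Submodule.mem_sup.1 hv'
    obtain ⟨h1, h2⟩ := key r hr s hs n hn w hw h.symm
    have h3 : s = w := by simpa [add_neg_eq_zero] using h2
    subst h1
    have hsT : s ∈ R ⊓ S := by
      refine ⟨?_, hs⟩
      rw [hR]
      refine ⟨hT ▸ Submodule.mem_sup_right hs, ?_⟩
      rw [← hTp, h3]
      exact Submodule.mem_sup_right hw
    have : s = 0 := by simpa [hRS] using hsT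
    simp [this]
  · rw [← hT, ← htop]; ac_rfl
  · rintro r ⟨hr, hv'⟩
    obtain ⟨s, hs, v, hv, h⟩ := Submodule.mem_sup.1 hv'
    obtain ⟨n, hn, w, hw, h'⟩ := Submodule.mem_sup.1 hv
    have := (key r hr (-s) (S.neg_mem hs) n hn w hw (by rw [← h, ← h']; abel)).1
    simp [this]
  · rw [← htop]; ac_rfl

end Decomposition

/-! ### Vector fields along a map, submanifolds -/

section Submanifold

variable {E : Type*} [NormedAddCommGroup E] [NormedSpace ℝ E]
  {N : Type*} [TopologicalSpace N] [ChartedSpace E N]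
  {F : Type*} [NormedAddCommGroup F] [NormedSpace ℝ F]
  {M : Type*} [TopologicalSpace M] [ChartedSpace F M]

/-- The image under the differential of `ι` of a vector field on the source of `ι`. -/
def pushVF (ι : M → N) (U : ∀ x : M, TangentSpace 𝓘(ℝ, F) x) (x : M) :
    TangentSpace 𝓘(ℝ, E) (ι x) :=
  mfderiv 𝓘(ℝ, F) 𝓘(ℝ, E) ι x (U x)

/-- The tangent space of the submanifold `ι : M → N`, as a subspace of the ambient tangent space. -/
def tangent (E : Type*) [NormedAddCommGroup E] [NormedSpace ℝ E]
    {N : Type*} [TopologicalSpace N] [ChartedSpace E N]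
    (F : Type*) [NormedAddCommGroup F] [NormedSpace ℝ F]
    {M : Type*} [TopologicalSpace M] [ChartedSpace F M] (ι : M → N) (x : M) :
    Submodule ℝ (TangentSpace 𝓘(ℝ, E) (ι x)) :=
  LinearMap.range (mfderiv 𝓘(ℝ, F) 𝓘(ℝ, E) ι x).toLinearMap

variable [IsManifold 𝓘(ℝ, E) ∞ N]

/-- A family of subspaces of the ambient tangent spaces along `ι` is a smooth vector subbundle of
rank `k` (of the restriction of the ambient tangent bundle to the submanifold): near every point it
is spanned by a smooth frame. -/
def IsSubbundleAlong (F : Type*) [NormedAddCommGroup F] [NormedSpace ℝ F]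
    {M : Type*} [TopologicalSpace M] [ChartedSpace F M] (ι : M → N)
    (W : ∀ x : M, Submodule ℝ (TangentSpace 𝓘(ℝ, E) (ι x))) (k : ℕ) : Prop :=
  ∀ x₀ : M, ∃ s : Set M, IsOpen s ∧ x₀ ∈ s ∧
    ∃ X : Fin k → ∀ x : M, TangentSpace 𝓘(ℝ, E) (ι x),
      (∀ i, ContMDiffOn 𝓘(ℝ, F) (𝓘(ℝ, E).prod 𝓘(ℝ, E)) ∞
        (fun x ↦ TotalSpace.mk' E (E := (TangentSpace 𝓘(ℝ, E) : N → Type _)) (ι x) (X i x)) s) ∧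
      ∀ x ∈ s, LinearIndependent ℝ (fun i ↦ X i x) ∧
        Submodule.span ℝ (Set.range fun i ↦ X i x) = W x

variable [FiniteDimensional ℝ E]

/-- The derivative `∇_u V` of a vector field `V` along `ι` in the direction of a tangent vector `u`
of the source: if `V = ∑ᵢ Vⁱ eᵢ` in a local frame `(eᵢ)` of the target, then
`∇_u V = ∑ᵢ (u(Vⁱ) eᵢ + Vⁱ ∇_{dι(u)} eᵢ)`. -/
def covAlong (conn : LinearConnection E N) (ι : M → N)
    (V : ∀ x : M, TangentSpace 𝓘(ℝ, E) (ι x)) (x : M) (u : TangentSpace 𝓘(ℝ, F) x) :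
    TangentSpace 𝓘(ℝ, E) (ι x) :=
  let t := trivializationAt E (TangentSpace 𝓘(ℝ, E) : N → Type _) (ι x)
  let b := finBasis ℝ E
  ∑ i, (mvfderiv 𝓘(ℝ, F)
          (fun y ↦ t.localFrameCoeff 𝓘(ℝ, E) b i (ι y) (V y)) x u • t.localFrame b i (ι x)
      + t.localFrameCoeff 𝓘(ℝ, E) b i (ι x) (V x) •
          conn (t.localFrame b i) (ι x) (mfderiv 𝓘(ℝ, F) 𝓘(ℝ, E) ι x u))

/-- The radical distribution `Rad(TM) = TM ∩ TM^⊥`. -/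
def radical (F : Type*) [NormedAddCommGroup F] [NormedSpace ℝ F]
    {M : Type*} [TopologicalSpace M] [ChartedSpace F M]
    (g : SemiRiemannianMetric E N) (ι : M → N) (x : M) :
    Submodule ℝ (TangentSpace 𝓘(ℝ, E) (ι x)) :=
  tangent E F ι x ⊓ (g.form (ι x)).orthogonal (tangent E F ι x)

/-- A lightlike submanifold `(M, g, S(TM), S(TM^⊥))` of `(N, g)`, given by an immersion `ι`, with a
lightlike transversal bundle `ltr(TM)`. All bundles are seen inside the ambient tangent spaces. -/
structure LightlikeSubmanifold (F : Type*) [NormedAddCommGroup F] [NormedSpace ℝ F]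
    {M : Type*} [TopologicalSpace M] [ChartedSpace F M]
    (g : SemiRiemannianMetric E N) (ι : M → N) where
  immersion : Manifold.IsImmersion 𝓘(ℝ, F) 𝓘(ℝ, E) ∞ ι
  /-- The radical distribution is smooth, of constant positive rank `r`. -/
  r : ℕ
  r_pos : 0 < r
  radical_subbundle : IsSubbundleAlong F ι (radical F g ι) r
  /-- The screen distribution `S(TM)`, a complement of the radical distribution in `TM`. -/
  screen : ∀ x : M, Submodule ℝ (TangentSpace 𝓘(ℝ, E) (ι x))
  screen_subbundle : ∃ k, IsSubbundleAlong F ι screen k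
  screen_disjoint : ∀ x, radical F g ι x ⊓ screen x = ⊥
  screen_sup : ∀ x, radical F g ι x ⊔ screen x = tangent E F ι x
  /-- The screen transversal bundle `S(TM^⊥)`, a complement of the radical distribution in
  `TM^⊥`. -/
  screenTransversal : ∀ x : M, Submodule ℝ (TangentSpace 𝓘(ℝ, E) (ι x))
  screenTransversal_subbundle : ∃ k, IsSubbundleAlong F ι screenTransversal k
  screenTransversal_disjoint : ∀ x, radical F g ι x ⊓ screenTransversal x = ⊥
  screenTransversal_sup : ∀ x, radical F g ι x ⊔ screenTransversal x =
    (g.form (ι x)).orthogonal (tangent E F ι x)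
  /-- The lightlike transversal bundle `ltr(TM)`, a totally null complement of the radical
  distribution in the orthogonal complement of `S(TM) ⊥ S(TM^⊥)`. -/
  ltr : ∀ x : M, Submodule ℝ (TangentSpace 𝓘(ℝ, E) (ι x))
  ltr_subbundle : ∃ k, IsSubbundleAlong F ι ltr k
  ltr_disjoint : ∀ x, radical F g ι x ⊓ ltr x = ⊥
  ltr_sup : ∀ x, radical F g ι x ⊔ ltr x =
    (g.form (ι x)).orthogonal (screen x ⊔ screenTransversal x)
  ltr_null : ∀ x, ∀ n ∈ ltr x, ∀ n' ∈ ltr x, g.val (ι x) n n' = 0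

namespace LightlikeSubmanifold

variable {g : SemiRiemannianMetric E N} {ι : M → N}

/-- The transversal bundle `tr(TM) = ltr(TM) ⊥ S(TM^⊥)`. -/
def transversal (L : LightlikeSubmanifold F g ι) (x : M) :
    Submodule ℝ (TangentSpace 𝓘(ℝ, E) (ι x)) :=
  L.ltr x ⊔ L.screenTransversal x

/-- The screen distribution as a distribution on `M`. -/
def screenDistribution (L : LightlikeSubmanifold F g ι) (x : M) :
    Submodule ℝ (TangentSpace 𝓘(ℝ, F) x) :=
  (L.screen x).comap (mfderiv 𝓘(ℝ, F) 𝓘(ℝ, E) ι x).toLinearMap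

theorem isCompl (L : LightlikeSubmanifold F g ι) (x : M) :
    IsCompl (tangent E F ι x) (L.transversal x) ∧
      IsCompl (radical F g ι x) (L.screen x ⊔ L.transversal x) := by
  have : FiniteDimensional ℝ (TangentSpace 𝓘(ℝ, E) (ι x)) := inferInstanceAs (FiniteDimensional ℝ E)
  have hs : (g.form (ι x)).IsSymm := ⟨fun a b ↦ g.symm (ι x) a b⟩
  refine isCompl_screens hs ?_ rfl (L.screen_disjoint x) (L.screen_sup x)
    (L.screenTransversal_disjoint x) (L.screenTransversal_sup x) (L.ltr_disjoint x) (L.ltr_sup x)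
  refine ⟨fun u hu ↦ g.nondegenerate _ u hu, fun u hu ↦ g.nondegenerate _ u fun v ↦ ?_⟩
  rw [g.symm]
  exact hu v

/-- The projection of the ambient tangent space onto `TM` along `tr(TM)`. -/
def tangentialPart (L : LightlikeSubmanifold F g ι) (x : M) :
    TangentSpace 𝓘(ℝ, E) (ι x) →ₗ[ℝ] TangentSpace 𝓘(ℝ, E) (ι x) :=
  Submodule.projection _ _ (L.isCompl x).1

/-- The projection of the ambient tangent space onto `Rad(TM)` along `S(TM) ⊕ tr(TM)`; on `TM` it is
the projection onto `Rad(TM)` along `S(TM)`. -/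
def radicalPart (L : LightlikeSubmanifold F g ι) (x : M) :
    TangentSpace 𝓘(ℝ, E) (ι x) →ₗ[ℝ] TangentSpace 𝓘(ℝ, E) (ι x) :=
  Submodule.projection _ _ (L.isCompl x).2

/-- The connection induced on `M` by a connection of the ambient manifold: `D_u V` is the tangential
part of the ambient derivative of `V`. Tangent vector fields `V` of `M` are seen as vector
fields along `ι`. -/
def inducedConnection (L : LightlikeSubmanifold F g ι) (conn : LinearConnection E N)
    (V : ∀ x : M, TangentSpace 𝓘(ℝ, E) (ι x)) (x : M) (u : TangentSpace 𝓘(ℝ, F) x) :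
    TangentSpace 𝓘(ℝ, E) (ι x) :=
  L.tangentialPart x (covAlong conn ι V x u)

/-- `h^*(U, V)` for a section `V` of `S(TM)`: the component in `Rad(TM)` of the induced derivative
`D_U V` in the decomposition `TM = S(TM) ⊥ Rad(TM)`. -/
def hStar (L : LightlikeSubmanifold F g ι) (conn : LinearConnection E N)
    (U : ∀ x : M, TangentSpace 𝓘(ℝ, F) x) (V : ∀ x : M, TangentSpace 𝓘(ℝ, E) (ι x)) (x : M) :
    TangentSpace 𝓘(ℝ, E) (ι x) :=
  L.radicalPart x (L.inducedConnection conn V x (U x))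

/-- `M` is an invariant lightlike submanifold: `J Rad(TM) = Rad(TM)` and `J S(TM) = S(TM)`. -/
def IsInvariant (L : LightlikeSubmanifold F g ι) {p q : ℕ} (S : MetallicStructure g p q) : Prop :=
  (∀ x, (radical F g ι x).map (S.J (ι x)).toLinearMap = radical F g ι x) ∧
    ∀ x, (L.screen x).map (S.J (ι x)).toLinearMap = L.screen x

end LightlikeSubmanifold

/-- `J` is parallel along the submanifold `ι`: `(∇_u J) v = 0` for all tangent vectors `u`, `v` of
the submanifold, that is, `∇_u (J Y) = J (∇_u Y)` for every vector field `Y` of the ambient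
manifold with value `v` at the point. -/
def IsParallelAlong (F : Type*) [NormedAddCommGroup F] [NormedSpace ℝ F]
    {M : Type*} [TopologicalSpace M] [ChartedSpace F M] {g : SemiRiemannianMetric E N}
    {p q : ℕ} (S : MetallicStructure g p q) (conn : LinearConnection E N) (ι : M → N) : Prop :=
  ∀ (x : M) (Y : ∀ y : N, TangentSpace 𝓘(ℝ, E) y), VectorFieldDifferentiableAt Y (ι x) →
    Y (ι x) ∈ tangent E F ι x → ∀ u ∈ tangent E F ι x,
      conn (fun y ↦ S.J y (Y y)) (ι x) u = S.J (ι x) (conn Y (ι x) u)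

end Submanifold

end MetallicLightlike

end

open MetallicLightlike

/-! Write `ρ` for the `Rad(TM)`-component of the tangential part of an ambient vector
(`radicalTangentialPart`). Three observations reduce the criterion to linear algebra at one point.
By invariance, `J U` lies in `S(TM)` when `U` does, so `ρ` kills the correction `π(V) J U` and `h^*`
may be computed with the Levi-Civita connection. Since `J` is parallel along `M`, `∇_U (J V) = J ∇_U
V`. Since `∇` is torsion-free, `∇_U V - ∇_V U = w`, where `w = [U, V]`. The stated identity
therefore says exactly `ρ (J w) = p ρ w`.

Split `w = r + s` along `Rad(TM)` and `S(TM)`, both preserved by `J`. The identity becomes `J r = p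
r`; then `J² r = p J r + q r` gives `q r = 0`, hence `r = 0`, that is, `w` lies in `S(TM)`. The
converse is immediate. This is `IsInvariant.radicalTangentialPart_J_eq_iff`.

Most of the work transfers the ambient properties to fields along `ι`, which need not extend to
ambient fields: `covAlong_quarterSymmetricConnection`, `IsParallelAlong.covAlong_J` and
`IsLeviCivita.covAlong_pushVF_sub`. The frame in `covAlong` is a coordinate frame, so the torsion
computation rests on the Lie bracket being a commutator of derivations (`mvfderiv_mlieBracket`). -/

noncomputable section

namespace MetallicLightlike

/-! ### The Lie bracket as a commutator of derivations. -/

section LieBracket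

open VectorField

variable {F : Type*} [NormedAddCommGroup F] [NormedSpace ℝ F]
  {M : Type*} [TopologicalSpace M] [ChartedSpace F M]

/-- A vector field, written in the extended chart at `x₀`. -/
def chartVF (x₀ : M) (V : ∀ x : M, TangentSpace 𝓘(ℝ, F) x) : F → F :=
  mpullbackWithin 𝓘(ℝ, F) 𝓘(ℝ, F) (extChartAt 𝓘(ℝ, F) x₀).symm V (Set.range 𝓘(ℝ, F))

theorem contDiffAt_comp_extChartAt_symm {x : M} {f : M → ℝ}
    (hf : ContMDiffAt 𝓘(ℝ, F) 𝓘(ℝ, ℝ) 2 f x) :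
    ContDiffAt ℝ 2 (f ∘ (extChartAt 𝓘(ℝ, F) x).symm) (extChartAt 𝓘(ℝ, F) x x) := by
  have := (contMDiffAt_iff.1 hf).2
  rw [show Set.range 𝓘(ℝ, F) = Set.univ by simp, contDiffWithinAt_univ] at this
  exact this

variable [IsManifold 𝓘(ℝ, F) ∞ M]

/-- The pullback applies the inverse of the derivative of the inverse chart, which is the derivative
of the chart. -/
theorem mfderiv_extChartAt_eq_chartVF {x₀ y : M} (hy : y ∈ (extChartAt 𝓘(ℝ, F) x₀).source)
    (V : ∀ x : M, TangentSpace 𝓘(ℝ, F) x) :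
    mfderiv 𝓘(ℝ, F) 𝓘(ℝ, F) (extChartAt 𝓘(ℝ, F) x₀) y (V y)
      = chartVF x₀ V (extChartAt 𝓘(ℝ, F) x₀ y) := by
  have h1 := mfderivWithin_extChartAt_symm_comp_mfderiv_extChartAt' hy
  have h2 := isInvertible_mfderivWithin_extChartAt_symm (I := 𝓘(ℝ, F))
    ((extChartAt 𝓘(ℝ, F) x₀).map_source hy)
  unfold chartVF
  rw [mpullbackWithin_apply]
  have h3 : V ((extChartAt 𝓘(ℝ, F) x₀).symm (extChartAt 𝓘(ℝ, F) x₀ y)) = V y := by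
    rw [(extChartAt 𝓘(ℝ, F) x₀).left_inv hy]
  obtain ⟨e, he⟩ := h2
  rw [← he, ContinuousLinearMap.inverse_equiv]
  rw [← he] at h1
  have h4 := DFunLike.congr_fun h1 (V y)
  change e _ = V y at h4
  exact (ContinuousLinearEquiv.eq_symm_apply e).2 (h4.trans h3.symm)

theorem differentiableAt_chartVF [CompleteSpace F] {x : M} {V : ∀ x : M, TangentSpace 𝓘(ℝ, F) x}
    (hV : VectorFieldDifferentiableAt V x) :
    DifferentiableAt ℝ (chartVF x V) (extChartAt 𝓘(ℝ, F) x x) := by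
  have := (mdifferentiableWithinAt_univ.2 hV).differentiableWithinAt_mpullbackWithin_vectorField
  rw [show (extChartAt 𝓘(ℝ, F) x).symm ⁻¹' Set.univ ∩ Set.range 𝓘(ℝ, F) = Set.univ by simp] at this
  exact differentiableWithinAt_univ.1 this

/-- An equality of germs, not only of values at `x`, because the function is differentiated once
more. -/
theorem mvfderiv_apply_eventuallyEq {x : M} {f : M → ℝ} (hf : ContMDiffAt 𝓘(ℝ, F) 𝓘(ℝ, ℝ) 2 f x)
    (V : ∀ x : M, TangentSpace 𝓘(ℝ, F) x) :
    (fun y ↦ mvfderiv 𝓘(ℝ, F) f y (V y)) =ᶠ[𝓝 x]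
      (fun z ↦ fderiv ℝ (f ∘ (extChartAt 𝓘(ℝ, F) x).symm) z (chartVF x V z))
        ∘ extChartAt 𝓘(ℝ, F) x := by
  have hd : ∀ᶠ y in 𝓝 x, MDifferentiableAt 𝓘(ℝ, F) 𝓘(ℝ, ℝ) f y :=
    (contMDiffAt_iff_contMDiffAt_nhds (by simp) |>.1 hf).mono fun y hy ↦ hy.mdifferentiableAt (by simp)
  filter_upwards [hd, extChartAt_source_mem_nhds (I := 𝓘(ℝ, F)) x] with y hy hys
  have hφ : MDifferentiableAt 𝓘(ℝ, F) 𝓘(ℝ, F) (extChartAt 𝓘(ℝ, F) x) y :=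
    mdifferentiableAt_extChartAt (by simpa using hys)
  have hinv := (extChartAt 𝓘(ℝ, F) x).left_inv hys
  have hF : MDifferentiableAt 𝓘(ℝ, F) 𝓘(ℝ, ℝ) (f ∘ (extChartAt 𝓘(ℝ, F) x).symm)
      (extChartAt 𝓘(ℝ, F) x y) := by
    have hs : MDifferentiableAt 𝓘(ℝ, F) 𝓘(ℝ, F) (extChartAt 𝓘(ℝ, F) x).symm
        (extChartAt 𝓘(ℝ, F) x y) :=
      (((contMDiffOn_extChartAt_symm x).contMDiffAt
        ((isOpen_extChartAt_target x).mem_nhds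
          ((extChartAt 𝓘(ℝ, F) x).map_source hys))).of_le le_rfl
          : ContMDiffAt _ _ 1 _ _).mdifferentiableAt (by simp)
    exact MDifferentiableAt.comp _ (by rwa [hinv]) hs
  have hfe : f =ᶠ[𝓝 y] (f ∘ (extChartAt 𝓘(ℝ, F) x).symm) ∘ extChartAt 𝓘(ℝ, F) x := by
    filter_upwards [(isOpen_extChartAt_source (I := 𝓘(ℝ, F)) x).mem_nhds hys] with z hz
    simp only [Function.comp_apply, (extChartAt 𝓘(ℝ, F) x).left_inv hz]
  have h1 : mvfderiv 𝓘(ℝ, F) f y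
      = mvfderiv 𝓘(ℝ, F) ((f ∘ (extChartAt 𝓘(ℝ, F) x).symm) ∘ extChartAt 𝓘(ℝ, F) x) y := by
    simp only [mvfderiv]
    exact hfe.mfderiv_eq
  rw [h1, mvfderiv_comp_apply y hF hφ, mfderiv_extChartAt_eq_chartVF hys]
  simp only [mvfderiv, mfderiv_eq_fderiv]
  rfl

theorem mdifferentiableAt_mvfderiv_apply [CompleteSpace F] {x : M} {f : M → ℝ}
    (hf : ContMDiffAt 𝓘(ℝ, F) 𝓘(ℝ, ℝ) 2 f x) {V : ∀ x : M, TangentSpace 𝓘(ℝ, F) x}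
    (hV : VectorFieldDifferentiableAt V x) :
    MDifferentiableAt 𝓘(ℝ, F) 𝓘(ℝ, ℝ) (fun y ↦ mvfderiv 𝓘(ℝ, F) f y (V y)) x := by
  refine MDifferentiableAt.congr_of_eventuallyEq ?_ (mvfderiv_apply_eventuallyEq hf V)
  refine MDifferentiableAt.comp x ?_ (mdifferentiableAt_extChartAt (by simp))
  refine DifferentiableAt.mdifferentiableAt ?_
  exact (((contDiffAt_comp_extChartAt_symm hf).fderiv_right (m := 1) (by norm_num)).differentiableAt
    (by simp)).clm_apply (differentiableAt_chartVF hV)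

/-- The product rule in the chart isolates the Hessian term, which cancels by symmetry when `U` and
`V` are exchanged. -/
theorem mvfderiv_mvfderiv_apply [CompleteSpace F] {x : M} {f : M → ℝ}
    (hf : ContMDiffAt 𝓘(ℝ, F) 𝓘(ℝ, ℝ) 2 f x) {U V : ∀ x : M, TangentSpace 𝓘(ℝ, F) x}
    (hV : VectorFieldDifferentiableAt V x) :
    mvfderiv 𝓘(ℝ, F) (fun y ↦ mvfderiv 𝓘(ℝ, F) f y (V y)) x (U x)
      = fderiv ℝ (fderiv ℝ (f ∘ (extChartAt 𝓘(ℝ, F) x).symm)) (extChartAt 𝓘(ℝ, F) x x)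
          (chartVF x U (extChartAt 𝓘(ℝ, F) x x)) (chartVF x V (extChartAt 𝓘(ℝ, F) x x))
        + fderiv ℝ (f ∘ (extChartAt 𝓘(ℝ, F) x).symm) (extChartAt 𝓘(ℝ, F) x x)
          (fderiv ℝ (chartVF x V) (extChartAt 𝓘(ℝ, F) x x)
            (chartVF x U (extChartAt 𝓘(ℝ, F) x x))) := by
  have hc := ((contDiffAt_comp_extChartAt_symm hf).fderiv_right (m := 1)
    (by norm_num)).differentiableAt (by simp)
  have hd := hc.clm_apply (differentiableAt_chartVF hV)
  have h1 : mvfderiv 𝓘(ℝ, F) (fun y ↦ mvfderiv 𝓘(ℝ, F) f y (V y)) x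
      = mvfderiv 𝓘(ℝ, F) ((fun z ↦ fderiv ℝ (f ∘ (extChartAt 𝓘(ℝ, F) x).symm) z (chartVF x V z))
        ∘ extChartAt 𝓘(ℝ, F) x) x := by
    simp only [mvfderiv]
    exact (mvfderiv_apply_eventuallyEq hf V).mfderiv_eq
  rw [h1, mvfderiv_comp_apply x hd.mdifferentiableAt (mdifferentiableAt_extChartAt (by simp)),
    mfderiv_extChartAt_eq_chartVF (mem_extChartAt_source x)]
  simp only [mvfderiv, mfderiv_eq_fderiv]
  change fderiv ℝ (fun z ↦ fderiv ℝ (f ∘ (extChartAt 𝓘(ℝ, F) x).symm) z (chartVF x V z)) _ _ = _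
  rw [fderiv_clm_apply hc (differentiableAt_chartVF hV)]
  simp [add_comm]

/-- The Lie bracket acts on functions as the commutator of derivations. -/
theorem mvfderiv_mlieBracket [CompleteSpace F] {x : M} {f : M → ℝ}
    (hf : ContMDiffAt 𝓘(ℝ, F) 𝓘(ℝ, ℝ) 2 f x) {U V : ∀ x : M, TangentSpace 𝓘(ℝ, F) x}
    (hU : VectorFieldDifferentiableAt U x) (hV : VectorFieldDifferentiableAt V x) :
    mvfderiv 𝓘(ℝ, F) (fun y ↦ mvfderiv 𝓘(ℝ, F) f y (V y)) x (U x)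
        - mvfderiv 𝓘(ℝ, F) (fun y ↦ mvfderiv 𝓘(ℝ, F) f y (U y)) x (V x)
      = mvfderiv 𝓘(ℝ, F) f x (mlieBracket 𝓘(ℝ, F) U V x) := by
  have hsymm := (contDiffAt_comp_extChartAt_symm hf).isSymmSndFDerivAt (by simp)
  have h1 := (mvfderiv_apply_eventuallyEq hf (mlieBracket 𝓘(ℝ, F) U V)).self_of_nhds
  have h2 : chartVF x (mlieBracket 𝓘(ℝ, F) U V) (extChartAt 𝓘(ℝ, F) x x)
      = lieBracket ℝ (chartVF x U) (chartVF x V) (extChartAt 𝓘(ℝ, F) x x) := by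
    rw [← mfderiv_extChartAt_eq_chartVF (mem_extChartAt_source x), ← mlieBracketWithin_univ,
      mlieBracketWithin_apply]
    -- The manifold bracket is the inverse of the chart's derivative applied to the bracket in the
    -- chart, so the two derivatives cancel.
    obtain ⟨e, he⟩ := isInvertible_mfderiv_extChartAt (I := 𝓘(ℝ, F)) (mem_extChartAt_source x)
    rw [← he, ContinuousLinearMap.inverse_equiv]
    refine (e.apply_symm_apply _).trans ?_
    rw [show (extChartAt 𝓘(ℝ, F) x).symm ⁻¹' Set.univ ∩ Set.range 𝓘(ℝ, F) = Set.univ by simp]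
    exact congrFun (lieBracketWithin_univ (E := F) (V := chartVF x U) (W := chartVF x V)) _
  simp only [Function.comp_apply] at h1
  rw [h1, h2, mvfderiv_mvfderiv_apply hf hV, mvfderiv_mvfderiv_apply hf hU, lieBracket_eq,
    map_sub, hsymm.eq (chartVF x U _)]
  ring

end LieBracket

/-! ### Coordinate frames and connections in coordinates. -/

section Frame

variable {E : Type*} [NormedAddCommGroup E] [NormedSpace ℝ E] [FiniteDimensional ℝ E]
  {N : Type*} [TopologicalSpace N] [ChartedSpace E N] [IsManifold 𝓘(ℝ, E) ∞ N]

/-- The local frame of the tangent bundle used in the definition of `covAlong`. -/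
def frame (z₀ : N) (i : Fin (finrank ℝ E)) (z : N) : TangentSpace 𝓘(ℝ, E) z :=
  (trivializationAt E (TangentSpace 𝓘(ℝ, E) : N → Type _) z₀).localFrame (finBasis ℝ E) i z

/-- The coefficients of tangent vectors in the local frame `frame z₀`. -/
def frameCoeff (z₀ : N) (i : Fin (finrank ℝ E)) (z : N) : TangentSpace 𝓘(ℝ, E) z →ₗ[ℝ] ℝ :=
  (trivializationAt E (TangentSpace 𝓘(ℝ, E) : N → Type _) z₀).localFrameCoeff 𝓘(ℝ, E)
    (finBasis ℝ E) i z

/-- The coordinate functions of the extended chart at `z₀`. -/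
def chartCoord (z₀ : N) (i : Fin (finrank ℝ E)) : N → ℝ :=
  ((finBasis ℝ E).coord i).toContinuousLinearMap ∘ extChartAt 𝓘(ℝ, E) z₀

omit [FiniteDimensional ℝ E] in
theorem eventually_mem_baseSet (z₀ : N) :
    ∀ᶠ z in 𝓝 z₀, z ∈ (trivializationAt E (TangentSpace 𝓘(ℝ, E) : N → Type _) z₀).baseSet :=
  (trivializationAt E (TangentSpace 𝓘(ℝ, E) : N → Type _) z₀).open_baseSet.mem_nhds
    (mem_baseSet_trivializationAt E _ z₀)

theorem sum_frameCoeff_smul_frame {z₀ z : N}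
    (hz : z ∈ (trivializationAt E (TangentSpace 𝓘(ℝ, E) : N → Type _) z₀).baseSet)
    (v : TangentSpace 𝓘(ℝ, E) z) : ∑ i, frameCoeff z₀ i z v • frame z₀ i z = v := by
  classical
  -- The expansion is available for sections, so `v` is extended by zero; no regularity of the
  -- extension is needed.
  have h := ((trivializationAt E (TangentSpace 𝓘(ℝ, E) : N → Type _)
    z₀).isLocalFrameOn_localFrame_baseSet 𝓘(ℝ, E) 1 (finBasis ℝ E)).coeff_sum_eq
    (Function.update (0 : ∀ z : N, TangentSpace 𝓘(ℝ, E) z) z v) hz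
  rw [Function.update_self] at h
  exact h.symm

theorem vectorFieldDifferentiableAt_frame (z₀ : N) (i : Fin (finrank ℝ E)) :
    VectorFieldDifferentiableAt (frame z₀ i) z₀ :=
  (contMDiffAt_localFrame_of_mem 1 (trivializationAt E (TangentSpace 𝓘(ℝ, E) : N → Type _) z₀)
    (finBasis ℝ E) i (mem_baseSet_trivializationAt E _ z₀)).mdifferentiableAt (by simp)

theorem mdifferentiableAt_frameCoeff {z₀ : N} {Y : ∀ z : N, TangentSpace 𝓘(ℝ, E) z}
    (hY : VectorFieldDifferentiableAt Y z₀) (i : Fin (finrank ℝ E)) :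
    MDifferentiableAt 𝓘(ℝ, E) 𝓘(ℝ, ℝ) (fun z ↦ frameCoeff z₀ i z (Y z)) z₀ :=
  mdifferentiableAt_localFrameCoeff (finBasis ℝ E) (mem_baseSet_trivializationAt E _ z₀) hY i

omit [IsManifold 𝓘(ℝ, E) ∞ N] in
theorem contMDiffAt_chartCoord (z₀ : N) (i : Fin (finrank ℝ E)) :
    ContMDiffAt 𝓘(ℝ, E) 𝓘(ℝ, ℝ) ∞ (chartCoord z₀ i) z₀ :=
  (ContinuousLinearMap.contMDiff _).contMDiffAt.comp z₀ contMDiffAt_extChartAt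

/-- The preferred trivialization of the tangent bundle is the derivative of the chart; hence the
frame is the coordinate frame and its coefficients are the differentials `dxⁱ`. -/
theorem frameCoeff_eq_mvfderiv {z₀ z : N}
    (hz : z ∈ (trivializationAt E (TangentSpace 𝓘(ℝ, E) : N → Type _) z₀).baseSet)
    (i : Fin (finrank ℝ E)) (v : TangentSpace 𝓘(ℝ, E) z) :
    frameCoeff z₀ i z v = mvfderiv 𝓘(ℝ, E) (chartCoord z₀ i) z v := by
  classical
  have hz' : z ∈ (chartAt E z₀).source := by simpa using hz
  have h1 := (trivializationAt E (TangentSpace 𝓘(ℝ, E) : N → Type _) z₀).localFrameCoeff_eq_coeff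
    (I := 𝓘(ℝ, E)) (b := finBasis ℝ E) hz (i := i) (s := Function.update (0 : ∀ z : N, TangentSpace 𝓘(ℝ, E) z) z v)
  have h2 := DFunLike.congr_fun
    (TangentBundle.continuousLinearMapAt_trivializationAt (I := 𝓘(ℝ, E)) hz') v
  rw [Bundle.Trivialization.continuousLinearMapAt_apply,
    Bundle.Trivialization.coe_linearMapAt_of_mem _ hz] at h2
  simp only [Function.update_self] at h1
  refine h1.trans ?_
  unfold chartCoord
  rw [mvfderiv_comp_apply z
    ((ContinuousLinearMap.contMDiff (n := 1) _).mdifferentiableAt (by simp))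
    (mdifferentiableAt_extChartAt hz')]
  refine (congrArg (fun w : E ↦ (finBasis ℝ E).repr w i) h2).trans ?_
  simp only [mvfderiv, mfderiv_eq_fderiv, ContinuousLinearMap.fderiv]
  rfl

theorem frameCoeff_frame {z₀ z : N}
    (hz : z ∈ (trivializationAt E (TangentSpace 𝓘(ℝ, E) : N → Type _) z₀).baseSet)
    (i j : Fin (finrank ℝ E)) : frameCoeff z₀ i z (frame z₀ j z) = if j = i then 1 else 0 := by
  unfold frameCoeff
  rw [Bundle.Trivialization.localFrameCoeff_apply_of_mem_baseSet (hx := hz), frame,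
    Bundle.Trivialization.localFrame_apply_of_mem_baseSet _ _ hz, Basis.repr_self,
    Finsupp.single_apply]

/-- The `k`-th coefficient of the bracket is its action on the coordinate `x^k`, a commutator of
derivatives of the locally constant functions `e_l(x^k)`, each 0 or 1. -/
theorem mlieBracket_frame (z₀ : N) (i j : Fin (finrank ℝ E)) :
    VectorField.mlieBracket 𝓘(ℝ, E) (frame z₀ i) (frame z₀ j) z₀ = 0 := by
  have hz₀ := (eventually_mem_baseSet (E := E) z₀).self_of_nhds
  have hconst : ∀ k l m : Fin (finrank ℝ E),
      mvfderiv 𝓘(ℝ, E) (fun z ↦ mvfderiv 𝓘(ℝ, E) (chartCoord z₀ k) z (frame z₀ l z)) z₀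
        (frame z₀ m z₀) = 0 := by
    intro k l m
    have h : (fun z ↦ mvfderiv 𝓘(ℝ, E) (chartCoord z₀ k) z (frame z₀ l z)) =ᶠ[𝓝 z₀]
        fun _ ↦ if l = k then (1 : ℝ) else 0 := by
      filter_upwards [eventually_mem_baseSet (E := E) z₀] with z hz
      rw [← frameCoeff_eq_mvfderiv hz, frameCoeff_frame hz]
    have h' : mvfderiv 𝓘(ℝ, E) (fun z ↦ mvfderiv 𝓘(ℝ, E) (chartCoord z₀ k) z (frame z₀ l z)) z₀
        = mvfderiv 𝓘(ℝ, E) (fun _ ↦ if l = k then (1 : ℝ) else 0) z₀ := by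
      simp only [mvfderiv]
      exact h.mfderiv_eq
    rw [h', mvfderiv_const]
    rfl
  have : CompleteSpace E := FiniteDimensional.complete ℝ E
  rw [← sum_frameCoeff_smul_frame hz₀ (VectorField.mlieBracket 𝓘(ℝ, E) _ _ z₀)]
  refine Finset.sum_eq_zero fun k _ ↦ ?_
  rw [frameCoeff_eq_mvfderiv hz₀, ← mvfderiv_mlieBracket
    ((contMDiffAt_chartCoord z₀ k).of_le (by norm_cast)) (vectorFieldDifferentiableAt_frame z₀ i)
    (vectorFieldDifferentiableAt_frame z₀ j), hconst, hconst, sub_zero, zero_smul]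

omit [FiniteDimensional ℝ E] in
theorem LinearConnection.map_sum (conn : LinearConnection E N) {ι : Type*} (s : Finset ι)
    {X : ι → ∀ z : N, TangentSpace 𝓘(ℝ, E) z} {z : N}
    (hX : ∀ i ∈ s, VectorFieldDifferentiableAt (X i) z) :
    conn (fun y ↦ ∑ i ∈ s, X i y) z = ∑ i ∈ s, conn (X i) z := by
  classical
  induction s using Finset.induction_on with
  | empty => exact congrFun conn.zero z
  | insert a s ha ih =>
    have h1 : VectorFieldDifferentiableAt (fun y ↦ ∑ i ∈ s, X i y) z :=
      MDifferentiableAt.sum_section fun i hi ↦ hX i (Finset.mem_insert_of_mem hi)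
    rw [Finset.sum_insert ha, ← ih fun i hi ↦ hX i (Finset.mem_insert_of_mem hi),
      ← conn.isCovariantDerivativeOnUniv.add (hX a (Finset.mem_insert_self a s)) h1]
    congr 1
    funext y
    simp [Finset.sum_insert ha]

omit [FiniteDimensional ℝ E] in
theorem vectorFieldDifferentiableAt_smul {f : N → ℝ} {X : ∀ z : N, TangentSpace 𝓘(ℝ, E) z} {z : N}
    (hf : MDifferentiableAt 𝓘(ℝ, E) 𝓘(ℝ, ℝ) f z) (hX : VectorFieldDifferentiableAt X z) :
    VectorFieldDifferentiableAt (fun y ↦ f y • X y) z :=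
  hf.smul_section hX

theorem LinearConnection.apply_sum_smul_frame (conn : LinearConnection E N) {z₀ : N}
    {f : Fin (finrank ℝ E) → N → ℝ}
    (hf : ∀ i, MDifferentiableAt 𝓘(ℝ, E) 𝓘(ℝ, ℝ) (f i) z₀) (u : TangentSpace 𝓘(ℝ, E) z₀) :
    conn (fun z ↦ ∑ i, f i z • frame z₀ i z) z₀ u
      = ∑ i, (mvfderiv 𝓘(ℝ, E) (f i) z₀ u • frame z₀ i z₀ + f i z₀ • conn (frame z₀ i) z₀ u) := by
  rw [LinearConnection.map_sum conn _ fun i _ ↦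
    vectorFieldDifferentiableAt_smul (hf i) (vectorFieldDifferentiableAt_frame z₀ i)]
  rw [sum_apply]
  refine Finset.sum_congr rfl fun i _ ↦ ?_
  have := conn.isCovariantDerivativeOnUniv.leibniz (vectorFieldDifferentiableAt_frame z₀ i) (hf i)
  have h2 := DFunLike.congr_fun this u
  rw [add_comm]
  exact h2

/-- The ambient counterpart of the formula defining `covAlong`: locality of the connection followed
by the Leibniz rule. -/
theorem LinearConnection.apply_eq_sum (conn : LinearConnection E N) {z₀ : N}
    {Y : ∀ z : N, TangentSpace 𝓘(ℝ, E) z} (hY : VectorFieldDifferentiableAt Y z₀)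
    (u : TangentSpace 𝓘(ℝ, E) z₀) :
    conn Y z₀ u = ∑ i, (mvfderiv 𝓘(ℝ, E) (fun z ↦ frameCoeff z₀ i z (Y z)) z₀ u • frame z₀ i z₀
      + frameCoeff z₀ i z₀ (Y z₀) • conn (frame z₀ i) z₀ u) := by
  have hc := mdifferentiableAt_frameCoeff hY
  rw [← LinearConnection.apply_sum_smul_frame conn hc]
  refine DFunLike.congr_fun (conn.isCovariantDerivativeOnUniv.congr_of_eventuallyEq hY
    (MDifferentiableAt.sum_section fun i _ ↦
      vectorFieldDifferentiableAt_smul (hc i) (vectorFieldDifferentiableAt_frame z₀ i))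
    Filter.univ_mem ?_) u
  filter_upwards [eventually_mem_baseSet (E := E) z₀] with z hz
  exact (sum_frameCoeff_smul_frame hz _).symm

/-- Symmetry of the Christoffel symbols: coordinate fields commute and the torsion vanishes. -/
theorem IsLeviCivita.frame_symm {g : SemiRiemannianMetric E N} {conn : LinearConnection E N}
    (h : IsLeviCivita g conn) (z₀ : N) (i j : Fin (finrank ℝ E)) :
    conn (frame z₀ i) z₀ (frame z₀ j z₀) = conn (frame z₀ j) z₀ (frame z₀ i z₀) := by
  have := h.torsion_free (frame z₀ j) (frame z₀ i) z₀ (vectorFieldDifferentiableAt_frame z₀ j)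
    (vectorFieldDifferentiableAt_frame z₀ i)
  rwa [mlieBracket_frame, sub_eq_zero] at this

end Frame

/-! ### Covariant derivatives of fields along `ι`. -/

section Along

theorem mvfderiv_sum_mul {F : Type*} [NormedAddCommGroup F] [NormedSpace ℝ F]
    {M : Type*} [TopologicalSpace M] [ChartedSpace F M] {κ : Type} (s : Finset κ)
    {a b : κ → M → ℝ} {x : M} (ha : ∀ i, MDifferentiableAt 𝓘(ℝ, F) 𝓘(ℝ, ℝ) (a i) x)
    (hb : ∀ i, MDifferentiableAt 𝓘(ℝ, F) 𝓘(ℝ, ℝ) (b i) x) (u : TangentSpace 𝓘(ℝ, F) x) :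
    mvfderiv 𝓘(ℝ, F) (∑ i ∈ s, a i * b i) x u
      = ∑ i ∈ s, (mvfderiv 𝓘(ℝ, F) (a i) x u * b i x + a i x * mvfderiv 𝓘(ℝ, F) (b i) x u) := by
  classical
  have hm : ∀ i, MDifferentiableAt 𝓘(ℝ, F) 𝓘(ℝ, ℝ) (a i * b i) x := fun i ↦ (ha i).mul (hb i)
  induction s using Finset.induction_on with
  | empty => simp
  | insert j s hj ih =>
    have hs : MDifferentiableAt 𝓘(ℝ, F) 𝓘(ℝ, ℝ) (∑ i ∈ s, a i * b i) x :=
      MDifferentiableAt.sum (f := fun i ↦ a i * b i) fun i _ ↦ hm i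
    rw [Finset.sum_insert hj, Finset.sum_insert hj, ← ih,
      mvfderiv_add (hm j) hs,
      mvfderiv_mul (ha j) (hb j)]
    simp only [add_apply, smul_apply, smul_eq_mul]
    ring

variable {E : Type*} [NormedAddCommGroup E] [NormedSpace ℝ E] [FiniteDimensional ℝ E]
  {N : Type*} [TopologicalSpace N] [ChartedSpace E N] [IsManifold 𝓘(ℝ, E) ∞ N]
  {F : Type*} [NormedAddCommGroup F] [NormedSpace ℝ F]
  {M : Type*} [TopologicalSpace M] [ChartedSpace F M] {ι : M → N}

theorem covAlong_eq (conn : LinearConnection E N) (V : ∀ x : M, TangentSpace 𝓘(ℝ, E) (ι x)) (x : M)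
    (u : TangentSpace 𝓘(ℝ, F) x) :
    covAlong conn ι V x u = ∑ i,
      (mvfderiv 𝓘(ℝ, F) (fun y ↦ frameCoeff (ι x) i (ι y) (V y)) x u • frame (ι x) i (ι x)
      + frameCoeff (ι x) i (ι x) (V x) •
          conn (frame (ι x) i) (ι x) (mfderiv 𝓘(ℝ, F) 𝓘(ℝ, E) ι x u)) :=
  rfl

theorem sum_frameCoeff_smul_frame_self (z₀ : N) (v : TangentSpace 𝓘(ℝ, E) z₀) :
    ∑ i, frameCoeff z₀ i z₀ v • frame z₀ i z₀ = v :=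
  sum_frameCoeff_smul_frame (eventually_mem_baseSet (E := E) z₀).self_of_nhds v

/-- The two connections differ by a tensor, so only the undifferentiated coefficients of `V`
contribute and `V` needs no differentiability. -/
theorem covAlong_quarterSymmetricConnection {g : SemiRiemannianMetric E N} {p q : ℕ}
    (S : MetallicStructure g p q) (η : ∀ x : N, TangentSpace 𝓘(ℝ, E) x)
    (conn : LinearConnection E N) (V : ∀ x : M, TangentSpace 𝓘(ℝ, E) (ι x)) (x : M)
    (u : TangentSpace 𝓘(ℝ, F) x) :
    covAlong (quarterSymmetricConnection g S η conn) ι V x u = covAlong conn ι V x u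
      + g.val (ι x) (η (ι x)) (V x) • S.J (ι x) (mfderiv 𝓘(ℝ, F) 𝓘(ℝ, E) ι x u) := by
  have h : ∀ (Y : ∀ z : N, TangentSpace 𝓘(ℝ, E) z) (z : N) (w : TangentSpace 𝓘(ℝ, E) z),
      quarterSymmetricConnection g S η conn Y z w
        = conn Y z w + g.val z (η z) (Y z) • S.J z w := fun _ _ _ ↦ rfl
  have hv : g.val (ι x) (η (ι x)) (V x)
      = ∑ i, frameCoeff (ι x) i (ι x) (V x) * g.val (ι x) (η (ι x)) (frame (ι x) i (ι x)) := by
    conv_lhs => rw [← sum_frameCoeff_smul_frame_self (ι x) (V x)]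
    rw [map_sum]
    simp only [map_smul, smul_eq_mul]
  simp only [covAlong_eq, h, smul_add, ← add_assoc, Finset.sum_add_distrib]
  rw [hv, Finset.sum_smul]
  simp only [smul_smul]

omit [FiniteDimensional ℝ E] in
theorem eventually_mem_baseSet_comp {x : M} (hι : ContinuousAt ι x) :
    ∀ᶠ y in 𝓝 x, ι y ∈
      (trivializationAt E (TangentSpace 𝓘(ℝ, E) : N → Type _) (ι x)).baseSet :=
  hι.eventually (eventually_mem_baseSet (E := E) (ι x))

omit [FiniteDimensional ℝ E] in
theorem MetallicStructure.vectorFieldDifferentiableAt_J {g : SemiRiemannianMetric E N} {p q : ℕ}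
    (S : MetallicStructure g p q) {Y : ∀ z : N, TangentSpace 𝓘(ℝ, E) z} {z : N}
    (hY : VectorFieldDifferentiableAt Y z) : VectorFieldDifferentiableAt (fun y ↦ S.J y (Y y)) z :=
  MDifferentiableAt.clm_bundle_apply (b := id) (F₁ := E) (F₂ := E)
    (S.smooth.mdifferentiableAt (by simp)) hY

/-- If `J` is parallel along `ι`, then `∇_u (J W) = J (∇_u W)` for a field `W` along `ι` which is
tangent at the point. -/
theorem IsParallelAlong.covAlong_J {g : SemiRiemannianMetric E N} {p q : ℕ}
    {S : MetallicStructure g p q} {conn : LinearConnection E N}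
    (hJ : IsParallelAlong F S conn ι) {x : M} (hι : MDifferentiableAt 𝓘(ℝ, F) 𝓘(ℝ, E) ι x)
    {W : ∀ x : M, TangentSpace 𝓘(ℝ, E) (ι x)}
    (hW : ∀ i, MDifferentiableAt 𝓘(ℝ, F) 𝓘(ℝ, ℝ) (fun y ↦ frameCoeff (ι x) i (ι y) (W y)) x)
    (hWx : W x ∈ tangent E F ι x) (u : TangentSpace 𝓘(ℝ, F) x) :
    covAlong conn ι (fun y ↦ S.J (ι y) (W y)) x u = S.J (ι x) (covAlong conn ι W x u) := by
  set z₀ := ι x with hz₀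
  set u' := mfderiv 𝓘(ℝ, F) 𝓘(ℝ, E) ι x u with hu'
  have hJe : ∀ i, VectorFieldDifferentiableAt (fun z ↦ S.J z (frame z₀ i z)) z₀ := fun i ↦
    S.vectorFieldDifferentiableAt_J (vectorFieldDifferentiableAt_frame z₀ i)
  have hJc := fun i ↦ mdifferentiableAt_frameCoeff (hJe i)
  -- the derivative of the coefficients of `J W`
  have hcoeff : ∀ k, mvfderiv 𝓘(ℝ, F) (fun y ↦ frameCoeff z₀ k (ι y) (S.J (ι y) (W y))) x u
      = ∑ i, (mvfderiv 𝓘(ℝ, F) (fun y ↦ frameCoeff z₀ i (ι y) (W y)) x u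
            * frameCoeff z₀ k z₀ (S.J z₀ (frame z₀ i z₀))
          + frameCoeff z₀ i z₀ (W x)
            * mvfderiv 𝓘(ℝ, E) (fun z ↦ frameCoeff z₀ k z (S.J z (frame z₀ i z))) z₀ u') := by
    intro k
    have hev : (fun y ↦ frameCoeff z₀ k (ι y) (S.J (ι y) (W y))) =ᶠ[𝓝 x]
        fun y ↦ ∑ i, frameCoeff z₀ i (ι y) (W y)
          * ((fun z ↦ frameCoeff z₀ k z (S.J z (frame z₀ i z))) ∘ ι) y := by
      filter_upwards [eventually_mem_baseSet_comp (E := E) hι.continuousAt] with y hy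
      conv_lhs => rw [← sum_frameCoeff_smul_frame hy (W y)]
      simp only [map_sum, map_smul, smul_eq_mul, Function.comp_apply]
      rfl
    have hcomp : ∀ i, MDifferentiableAt 𝓘(ℝ, F) 𝓘(ℝ, ℝ)
        ((fun z ↦ frameCoeff z₀ k z (S.J z (frame z₀ i z))) ∘ ι) x :=
      fun i ↦ (hJc i k).comp x hι
    have h1 : mvfderiv 𝓘(ℝ, F) (fun y ↦ frameCoeff z₀ k (ι y) (S.J (ι y) (W y))) x
        = mvfderiv 𝓘(ℝ, F) (∑ i, (fun y ↦ frameCoeff z₀ i (ι y) (W y))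
          * ((fun z ↦ frameCoeff z₀ k z (S.J z (frame z₀ i z))) ∘ ι)) x := by
      have : (∑ i, (fun y ↦ frameCoeff z₀ i (ι y) (W y))
          * ((fun z ↦ frameCoeff z₀ k z (S.J z (frame z₀ i z))) ∘ ι))
          = fun y ↦ ∑ i, frameCoeff z₀ i (ι y) (W y)
          * ((fun z ↦ frameCoeff z₀ k z (S.J z (frame z₀ i z))) ∘ ι) y := by
        funext y
        simp [Finset.sum_apply]
      rw [this]
      simp only [mvfderiv]
      exact hev.mfderiv_eq
    rw [h1, mvfderiv_sum_mul _ hW hcomp]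
    refine Finset.sum_congr rfl fun i _ ↦ ?_
    rw [mvfderiv_comp_apply x (hJc i k) hι]
    rfl
  -- the constant coefficient extension of `W x`
  set Y : ∀ z : N, TangentSpace 𝓘(ℝ, E) z :=
    fun z ↦ ∑ i, frameCoeff z₀ i z₀ (W x) • frame z₀ i z with hYdef
  have hY : VectorFieldDifferentiableAt Y z₀ := MDifferentiableAt.sum_section fun i _ ↦
    vectorFieldDifferentiableAt_smul mdifferentiableAt_const (vectorFieldDifferentiableAt_frame z₀ i)
  have hYx : Y z₀ = W x := sum_frameCoeff_smul_frame_self z₀ (W x)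
  have hconnY : conn Y z₀ u' = ∑ i, frameCoeff z₀ i z₀ (W x) • conn (frame z₀ i) z₀ u' := by
    rw [hYdef, LinearConnection.apply_sum_smul_frame conn
      (f := fun i _ ↦ frameCoeff z₀ i z₀ (W x)) (fun i ↦ mdifferentiableAt_const)]
    simp [mvfderiv_const]
  -- Parallelism concerns ambient fields, so it is applied to `Y`, which has the tangent value `W x`
  -- at the point.
  have hpar := hJ x Y hY (hYx ▸ hWx) u' ⟨u, rfl⟩
  rw [LinearConnection.apply_eq_sum conn (S.vectorFieldDifferentiableAt_J hY)] at hpar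
  have hcY : ∀ k, mvfderiv 𝓘(ℝ, E) (fun z ↦ frameCoeff z₀ k z (S.J z (Y z))) z₀ u'
      = ∑ i, frameCoeff z₀ i z₀ (W x)
          * mvfderiv 𝓘(ℝ, E) (fun z ↦ frameCoeff z₀ k z (S.J z (frame z₀ i z))) z₀ u' := by
    intro k
    have : (fun z ↦ frameCoeff z₀ k z (S.J z (Y z)))
        = ∑ i, (fun _ ↦ frameCoeff z₀ i z₀ (W x))
          * (fun z ↦ frameCoeff z₀ k z (S.J z (frame z₀ i z))) := by
      funext z
      simp [hYdef, Finset.sum_apply]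
    rw [this, mvfderiv_sum_mul _ (fun i ↦ mdifferentiableAt_const) (fun i ↦ hJc i k)]
    simp [mvfderiv_const]
  -- The derivatives of the coefficients of `W` do not occur for `Y`; their contribution commutes
  -- with `J` by pointwise linearity alone.
  have hlead : ∑ k, (∑ i, mvfderiv 𝓘(ℝ, F) (fun y ↦ frameCoeff z₀ i (ι y) (W y)) x u
      * frameCoeff z₀ k z₀ (S.J z₀ (frame z₀ i z₀))) • frame z₀ k z₀
      = ∑ i, mvfderiv 𝓘(ℝ, F) (fun y ↦ frameCoeff z₀ i (ι y) (W y)) x u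
        • S.J z₀ (frame z₀ i z₀) := by
    simp only [Finset.sum_smul, mul_smul]
    rw [Finset.sum_comm]
    simp only [← Finset.smul_sum, sum_frameCoeff_smul_frame_self]
  rw [covAlong_eq, covAlong_eq]
  simp only [← hz₀, ← hu', hcoeff, Finset.sum_add_distrib, add_smul, map_add]
  rw [hlead, ← hconnY, ← hpar]
  simp only [hcY, hYx, Finset.sum_add_distrib, map_sum, map_smul]
  exact add_assoc _ _ _

/-- The coefficients of `ι_* U` in the chart at `ι x` are derivatives along `U`. -/
theorem frameCoeff_pushVF_eventuallyEq {x : M} [IsManifold 𝓘(ℝ, F) ∞ M]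
    (hι : ContMDiff 𝓘(ℝ, F) 𝓘(ℝ, E) ∞ ι)
    (U : ∀ x : M, TangentSpace 𝓘(ℝ, F) x) (i : Fin (finrank ℝ E)) :
    (fun y ↦ frameCoeff (ι x) i (ι y) (pushVF ι U y)) =ᶠ[𝓝 x]
      fun y ↦ mvfderiv 𝓘(ℝ, F) (chartCoord (E := E) (ι x) i ∘ ι) y (U y) := by
  have hc : ∀ᶠ z in 𝓝 (ι x), MDifferentiableAt 𝓘(ℝ, E) 𝓘(ℝ, ℝ) (chartCoord (E := E) (ι x) i) z :=
    ((contMDiffAt_iff_contMDiffAt_nhds (n := 1) (by simp)).1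
      ((contMDiffAt_chartCoord (ι x) i).of_le (by norm_cast))).mono
      fun z hz ↦ hz.mdifferentiableAt (by simp)
  filter_upwards [eventually_mem_baseSet_comp (E := E) hι.continuous.continuousAt,
    hι.continuous.continuousAt.eventually hc] with y hy hyc
  rw [frameCoeff_eq_mvfderiv hy, mvfderiv_comp_apply y hyc (hι.mdifferentiableAt (by simp))]
  rfl

omit [IsManifold 𝓘(ℝ, E) ∞ N] in
theorem contMDiffAt_chartCoord_comp {x : M} (hι : ContMDiff 𝓘(ℝ, F) 𝓘(ℝ, E) ∞ ι)
    (i : Fin (finrank ℝ E)) :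
    ContMDiffAt 𝓘(ℝ, F) 𝓘(ℝ, ℝ) 2 (chartCoord (E := E) (ι x) i ∘ ι) x :=
  ((contMDiffAt_chartCoord (ι x) i).comp x hι.contMDiffAt).of_le (by norm_cast)

/-- The coefficients are the derivatives `U(xⁱ ∘ ι)`, so smoothness of `ι` and differentiability of
`U` suffice. This supplies the regularity required by `IsParallelAlong.covAlong_J`. -/
theorem mdifferentiableAt_frameCoeff_pushVF [CompleteSpace F] [IsManifold 𝓘(ℝ, F) ∞ M] {x : M}
    (hι : ContMDiff 𝓘(ℝ, F) 𝓘(ℝ, E) ∞ ι) {U : ∀ x : M, TangentSpace 𝓘(ℝ, F) x}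
    (hU : VectorFieldDifferentiableAt U x) (i : Fin (finrank ℝ E)) :
    MDifferentiableAt 𝓘(ℝ, F) 𝓘(ℝ, ℝ) (fun y ↦ frameCoeff (ι x) i (ι y) (pushVF ι U y)) x :=
  (mdifferentiableAt_mvfderiv_apply (contMDiffAt_chartCoord_comp hι i) hU).congr_of_eventuallyEq
    (frameCoeff_pushVF_eventuallyEq hι U i)

/-- The derivative along `ι` defined by the Levi-Civita connection is torsion-free. -/
theorem IsLeviCivita.covAlong_pushVF_sub [CompleteSpace F] [IsManifold 𝓘(ℝ, F) ∞ M]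
    {g : SemiRiemannianMetric E N} {conn : LinearConnection E N} (hconn : IsLeviCivita g conn)
    (hι : ContMDiff 𝓘(ℝ, F) 𝓘(ℝ, E) ∞ ι) {U V : ∀ x : M, TangentSpace 𝓘(ℝ, F) x} {x : M}
    (hU : VectorFieldDifferentiableAt U x) (hV : VectorFieldDifferentiableAt V x) :
    covAlong conn ι (pushVF ι V) x (U x) - covAlong conn ι (pushVF ι U) x (V x)
      = pushVF ι (VectorField.mlieBracket 𝓘(ℝ, F) U V) x := by
  have hd : ∀ (X : ∀ x : M, TangentSpace 𝓘(ℝ, F) x) i,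
      mvfderiv 𝓘(ℝ, F) (fun y ↦ frameCoeff (ι x) i (ι y) (pushVF ι X y)) x
        = mvfderiv 𝓘(ℝ, F)
          (fun y ↦ mvfderiv 𝓘(ℝ, F) (chartCoord (E := E) (ι x) i ∘ ι) y (X y)) x := by
    intro X i
    simp only [mvfderiv]
    exact (frameCoeff_pushVF_eventuallyEq hι X i).mfderiv_eq
  have hlin : ∀ (i : Fin (finrank ℝ E)) (X : ∀ x : M, TangentSpace 𝓘(ℝ, F) x),
      conn (frame (ι x) i) (ι x) (mfderiv 𝓘(ℝ, F) 𝓘(ℝ, E) ι x (X x))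
        = ∑ j, frameCoeff (ι x) j (ι x) (pushVF ι X x)
          • conn (frame (ι x) i) (ι x) (frame (ι x) j (ι x)) := by
    intro i X
    conv_lhs => rw [← sum_frameCoeff_smul_frame_self (ι x) (mfderiv 𝓘(ℝ, F) 𝓘(ℝ, E) ι x (X x))]
    simp only [map_sum, map_smul]
    rfl
  -- The Christoffel terms are symmetric in `U` and `V`, so they drop out of the difference.
  have hsymm : ∑ i, frameCoeff (ι x) i (ι x) (pushVF ι V x) •
        conn (frame (ι x) i) (ι x) (mfderiv 𝓘(ℝ, F) 𝓘(ℝ, E) ι x (U x))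
      = ∑ i, frameCoeff (ι x) i (ι x) (pushVF ι U x) •
        conn (frame (ι x) i) (ι x) (mfderiv 𝓘(ℝ, F) 𝓘(ℝ, E) ι x (V x)) := by
    simp only [hlin, Finset.smul_sum]
    rw [Finset.sum_comm]
    refine Finset.sum_congr rfl fun i _ ↦ Finset.sum_congr rfl fun j _ ↦ ?_
    rw [hconn.frame_symm, smul_comm]
  rw [covAlong_eq, covAlong_eq, Finset.sum_add_distrib, Finset.sum_add_distrib, hsymm,
    add_sub_add_right_eq_sub, ← Finset.sum_sub_distrib,
    ← sum_frameCoeff_smul_frame_self (ι x) (pushVF ι (VectorField.mlieBracket 𝓘(ℝ, F) U V) x)]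
  refine Finset.sum_congr rfl fun i _ ↦ ?_
  -- What remains is the commutator of `U` and `V` acting on `xⁱ ∘ ι`, the `i`-th coefficient of the
  -- pushed-forward bracket.
  rw [← sub_smul, hd, hd, mvfderiv_mlieBracket (contMDiffAt_chartCoord_comp hι i) hU hV]
  exact congrArg (· • _) (frameCoeff_pushVF_eventuallyEq (x := x) hι _ i).self_of_nhds.symm

end Along

/-! ### Radical components and the integrability criterion. -/

section Screen

variable {E : Type*} [NormedAddCommGroup E] [NormedSpace ℝ E] [FiniteDimensional ℝ E]
  {N : Type*} [TopologicalSpace N] [ChartedSpace E N] [IsManifold 𝓘(ℝ, E) ∞ N]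
  {F : Type*} [NormedAddCommGroup F] [NormedSpace ℝ F]
  {M : Type*} [TopologicalSpace M] [ChartedSpace F M] {ι : M → N}
  {g : SemiRiemannianMetric E N} {p q : ℕ} {S : MetallicStructure g p q}

namespace LightlikeSubmanifold

variable (L : LightlikeSubmanifold F g ι) {x : M}

/-- The `Rad(TM)`-component of the tangential part of an ambient vector. -/
def radicalTangentialPart (x : M) :
    TangentSpace 𝓘(ℝ, E) (ι x) →ₗ[ℝ] TangentSpace 𝓘(ℝ, E) (ι x) :=
  L.radicalPart x ∘ₗ L.tangentialPart x

omit [FiniteDimensional ℝ E] in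
theorem screen_le_tangent (x : M) : L.screen x ≤ tangent E F ι x :=
  (L.screen_sup x).symm ▸ le_sup_right

theorem radicalTangentialPart_of_mem_screen {v : TangentSpace 𝓘(ℝ, E) (ι x)}
    (hv : v ∈ L.screen x) : L.radicalTangentialPart x v = 0 := by
  have h1 : L.tangentialPart x v = v :=
    (Submodule.projection_eq_self_iff (L.isCompl x).1 v).2 (L.screen_le_tangent x hv)
  change L.radicalPart x (L.tangentialPart x v) = 0
  rw [h1]
  exact (Submodule.projection_apply_eq_zero_iff (L.isCompl x).2).2 (Submodule.mem_sup_left hv)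

theorem radicalTangentialPart_of_mem_radical {v : TangentSpace 𝓘(ℝ, E) (ι x)}
    (hv : v ∈ radical F g ι x) : L.radicalTangentialPart x v = v := by
  have h1 : L.tangentialPart x v = v :=
    (Submodule.projection_eq_self_iff (L.isCompl x).1 v).2 hv.1
  change L.radicalPart x (L.tangentialPart x v) = v
  rw [h1]
  exact (Submodule.projection_eq_self_iff (L.isCompl x).2 v).2 hv

variable {L}

/-- The algebraic core: `p` is not an eigenvalue of `J`, since it is not a root of `t² = p t + q`
when `q > 0`. -/
theorem IsInvariant.radicalTangentialPart_J_eq_iff (hL : L.IsInvariant S) (hq : 0 < q)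
    {w : TangentSpace 𝓘(ℝ, E) (ι x)} (hw : w ∈ tangent E F ι x) :
    L.radicalTangentialPart x (S.J (ι x) w) = (p : ℝ) • L.radicalTangentialPart x w
      ↔ w ∈ L.screen x := by
  rw [← L.screen_sup x] at hw
  obtain ⟨r, hr, s, hs, rfl⟩ := Submodule.mem_sup.1 hw
  have hJr : S.J (ι x) r ∈ radical F g ι x := hL.1 x ▸ Submodule.mem_map_of_mem hr
  have hJs : S.J (ι x) s ∈ L.screen x := hL.2 x ▸ Submodule.mem_map_of_mem hs
  rw [map_add, map_add, map_add, L.radicalTangentialPart_of_mem_radical hr,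
    L.radicalTangentialPart_of_mem_radical hJr, L.radicalTangentialPart_of_mem_screen hs,
    L.radicalTangentialPart_of_mem_screen hJs, add_zero, add_zero]
  constructor
  · intro h
    have h2 := S.sq (ι x) r
    -- With `J r = p r`, both sides of `J² r = p J r + q r` contain `p² r`, which leaves `q r = 0`.
    rw [h, map_smul, h] at h2
    have hq' : (q : ℝ) • r = 0 := by simpa using h2
    have hr0 : r = 0 := (smul_eq_zero.1 hq').resolve_left (by exact_mod_cast hq.ne')
    rwa [hr0, zero_add]
  · intro h
    have hrS : r ∈ L.screen x := by simpa using (L.screen x).sub_mem h hs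
    have hr0 : r ∈ radical F g ι x ⊓ L.screen x := ⟨hr, hrS⟩
    rw [L.screen_disjoint, Submodule.mem_bot] at hr0
    simp [hr0]

/-- The correction term is a multiple of `J U`, which invariance keeps in the screen. The field `W`
is arbitrary, so this covers both `V` and `J V`. -/
theorem IsInvariant.hStar_quarterSymmetricConnection (hL : L.IsInvariant S)
    (η : ∀ x : N, TangentSpace 𝓘(ℝ, E) x) (conn : LinearConnection E N)
    {U : ∀ x : M, TangentSpace 𝓘(ℝ, F) x} (hU : U x ∈ L.screenDistribution x)
    (W : ∀ x : M, TangentSpace 𝓘(ℝ, E) (ι x)) :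
    L.hStar (quarterSymmetricConnection g S η conn) U W x
      = L.radicalTangentialPart x (covAlong conn ι W x (U x)) := by
  change L.radicalTangentialPart x (covAlong (quarterSymmetricConnection g S η conn) ι W x (U x))
    = _
  have hJ : S.J (ι x) (mfderiv 𝓘(ℝ, F) 𝓘(ℝ, E) ι x (U x)) ∈ L.screen x :=
    hL.2 x ▸ Submodule.mem_map_of_mem (show _ ∈ L.screen x from hU)
  rw [covAlong_quarterSymmetricConnection, map_add, map_smul,
    L.radicalTangentialPart_of_mem_screen hJ, smul_zero, add_zero]

/-- Pointwise form of the integrability criterion. -/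
theorem IsInvariant.mlieBracket_mem_screenDistribution_iff [CompleteSpace F]
    [IsManifold 𝓘(ℝ, F) ∞ M] (hL : L.IsInvariant S) (hq : 0 < q) {conn : LinearConnection E N}
    (hconn : IsLeviCivita g conn) (hJ : IsParallelAlong F S conn ι)
    (η : ∀ x : N, TangentSpace 𝓘(ℝ, E) x) {U V : ∀ x : M, TangentSpace 𝓘(ℝ, F) x}
    (hU : VectorFieldDifferentiableAt U x) (hV : VectorFieldDifferentiableAt V x)
    (hUS : U x ∈ L.screenDistribution x) (hVS : V x ∈ L.screenDistribution x) :
    VectorField.mlieBracket 𝓘(ℝ, F) U V x ∈ L.screenDistribution x ↔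
      L.hStar (quarterSymmetricConnection g S η conn) V (fun y ↦ S.J (ι y) (pushVF ι U y)) x
          + (p : ℝ) • L.hStar (quarterSymmetricConnection g S η conn) U (pushVF ι V) x
        = L.hStar (quarterSymmetricConnection g S η conn) U (fun y ↦ S.J (ι y) (pushVF ι V y)) x
          + (p : ℝ) • L.hStar (quarterSymmetricConnection g S η conn) V (pushVF ι U) x := by
  have hι := L.immersion.contMDiff
  have hpar : ∀ {X : ∀ x : M, TangentSpace 𝓘(ℝ, F) x}, VectorFieldDifferentiableAt X x →
      ∀ u, covAlong conn ι (fun y ↦ S.J (ι y) (pushVF ι X y)) x u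
        = S.J (ι x) (covAlong conn ι (pushVF ι X) x u) := fun {X} hX u ↦
    hJ.covAlong_J (hι.mdifferentiableAt (by simp)) (mdifferentiableAt_frameCoeff_pushVF hι hX)
      ⟨X x, rfl⟩ u
  have hw := hconn.covAlong_pushVF_sub hι hU hV
  have hmem : pushVF ι (VectorField.mlieBracket 𝓘(ℝ, F) U V) x ∈ tangent E F ι x := ⟨_, rfl⟩
  rw [hL.hStar_quarterSymmetricConnection η conn hUS, hL.hStar_quarterSymmetricConnection η conn hUS,
    hL.hStar_quarterSymmetricConnection η conn hVS, hL.hStar_quarterSymmetricConnection η conn hVS,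
    hpar hU, hpar hV]
  -- Membership becomes `ρ (J w) = p ρ w`; substituting `w = ∇_U V - ∇_V U` and rearranging gives
  -- the stated identity.
  refine (hL.radicalTangentialPart_J_eq_iff hq hmem).symm.trans ?_
  rw [← hw, map_sub, map_sub, map_sub, smul_sub, sub_eq_sub_iff_add_eq_add, eq_comm, add_comm]

end LightlikeSubmanifold

end Screen

end MetallicLightlike

end

theorem mainTheorem2
    {E : Type*} [NormedAddCommGroup E] [NormedSpace ℝ E] [FiniteDimensional ℝ E]
    {N : Type*} [TopologicalSpace N] [T2Space N] [SecondCountableTopology N]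
    [ChartedSpace E N] [IsManifold 𝓘(ℝ, E) ∞ N]
    {F : Type*} [NormedAddCommGroup F] [NormedSpace ℝ F] [FiniteDimensional ℝ F]
    {M : Type*} [TopologicalSpace M] [T2Space M] [SecondCountableTopology M]
    [ChartedSpace F M] [IsManifold 𝓘(ℝ, F) ∞ M]
    (g : SemiRiemannianMetric E N) {p q : ℕ} (hp : 0 < p) (hq : 0 < q)
    (S : MetallicStructure g p q)
    (conn : LinearConnection E N) (hconn : IsLeviCivita g conn)
    (η : ∀ x : N, TangentSpace 𝓘(ℝ, E) x) (hη : IsSmoothVectorField η)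
    (ι : M → N) (L : LightlikeSubmanifold F g ι) (hL : L.IsInvariant S)
    (hJ : IsParallelAlong F S conn ι) :
    let D := quarterSymmetricConnection g S η conn
    let J' : (∀ x : M, TangentSpace 𝓘(ℝ, F) x) → ∀ x : M, TangentSpace 𝓘(ℝ, E) (ι x) :=
      fun U x ↦ S.J (ι x) (pushVF ι U x)
    IsIntegrableDistribution L.screenDistribution ↔
      ∀ U V : ∀ x : M, TangentSpace 𝓘(ℝ, F) x, IsSmoothVectorField U → IsSmoothVectorField V →
        (∀ x, U x ∈ L.screenDistribution x) → (∀ x, V x ∈ L.screenDistribution x) →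
        ∀ x : M, L.hStar D V (J' U) x + (p : ℝ) • L.hStar D U (pushVF ι V) x
          = L.hStar D U (J' V) x + (p : ℝ) • L.hStar D V (pushVF ι U) x := by

  intro D J'
  have hF : CompleteSpace F := FiniteDimensional.complete ℝ F
  have key : ∀ U V : ∀ x : M, TangentSpace 𝓘(ℝ, F) x,
      IsSmoothVectorField U → IsSmoothVectorField V →
      (∀ x, U x ∈ L.screenDistribution x) → (∀ x, V x ∈ L.screenDistribution x) → ∀ x,
      (VectorField.mlieBracket 𝓘(ℝ, F) U V x ∈ L.screenDistribution x ↔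
        L.hStar D V (J' U) x + (p : ℝ) • L.hStar D U (pushVF ι V) x
          = L.hStar D U (J' V) x + (p : ℝ) • L.hStar D V (pushVF ι U) x) :=
    fun U V hU hV hUS hVS x ↦ hL.mlieBracket_mem_screenDistribution_iff hq hconn hJ η
      (hU.mdifferentiableAt (by simp)) (hV.mdifferentiableAt (by simp)) (hUS x) (hVS x)
  -- The equivalence holds for each pair of fields at each point, so the quantifiers match term by
  -- term.
  exact forall₂_congr fun U V ↦ forall₄_congr fun hU hV hUS hVS ↦
    forall_congr' fun x ↦ key U V hU hV hUS hVS x
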